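/- Let $n \ge 1$ be an integer and let $p$ be an odd prime with $p > \frac{n+1}{2}$. Let $B_k$ denote the Bernoulli numbers, defined by $\frac{x}{e^x-1} = \sum_{k\ge 0} B_k \frac{x^k}{k!}$, let $H^{(m)}_{N} = \sum_{k=1}^{N} \frac{1}{k^m}$ be the generalized harmonic numbers, and let $q_p = \frac{2^{p-1}-1}{p}$ be the base-$2$ Fermat quotient. Then $$\sum_{j=0}^{n-1}\frac{(2^{j+1}-1)(2^{j+2}-1)\,B_{j+2}}{(j+1)(j+2)\,2^{j-1}}\,H^{(j+1)}_{\frac{p-1}{2}}\,p^j+\sum_{j=0}^{n-1}(-1)^j\,\frac{q_p^{\,j+1}}{j+1}\,p^j\equiv 0 \pmod{p^n},$$ where, for rational numbers $x,y$, $x \equiv y \pmod{p^n}$ means that $x-y = p^n\,\frac{a}{b}$ for some integers $a,b$ with $p \nmid b$. -/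

import Mathlib

/-- The generalized harmonic number `∑_{k=1}^{N} 1 / k ^ m`. -/
def genHarmonic (m N : ℕ) : ℚ :=
  ∑ k ∈ Finset.Icc 1 N, 1 / (k : ℚ) ^ m

/-- The base-2 Fermat quotient `(2 ^ (p - 1) - 1) / p`. -/
def fermatQuotientTwo (p : ℕ) : ℚ :=
  ((2 : ℚ) ^ (p - 1) - 1) / (p : ℚ)

/-- Congruence of rational numbers modulo `p ^ n`: the difference `x - y` is `p ^ n` times a
`p`-integral rational, i.e. a fraction whose denominator is not divisible by `p`. -/
def RatModEqPrimePow (p n : ℕ) (x y : ℚ) : Prop :=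
  ∃ a b : ℤ, ¬ (p : ℤ) ∣ b ∧ x - y = (p : ℚ) ^ n * ((a : ℚ) / (b : ℚ))

/-!
Let `E_j` be the value at `0` of the `j`-th Euler polynomial, `m = (p - 1) / 2`, and
`G(t) = ∑ 2 E_{j+1} / (j+1) t ^ (j+1)`. Truncating all series at degree `n`, `p` times the left-hand
side is `log (2 ^ (p - 1)) + ∑ (G(p / 2k) - G(p / k))`, summed over `1 ≤ k ≤ m`. Write
`G(t) = log (1 - t) + I(t)`.

* The generating function of `E_j` makes `I` invariant under `t ↦ t / (t - 1)`, which maps `p / k`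
  to `p / (p - k)`. Both the pairs `{k, p - k}` and the pairs `{2k, p - 2k}` exhaust
  `{1, …, p - 1}`, so the sums of `I(p / k)` and of `I(p / 2k)` agree.
* The logarithms cancel because `2 ^ (p - 1) ∏ (1 - p / 2k) = ∏ (1 - p / k)`.

As `n + 1 < 2p`, the only denominator divisible by `p` that occurs is `p` itself, and Frobenius
or `1 + 2 E_p ≡ 0 (mod p)` makes up for it, so both statements hold modulo `p ^ (n + 1)`.
-/

section Reflection

open Finset

variable {R : Type*} [CommRing R]

theorem one_sub_mul_sum_choose_mul_pow (t : R) (j n : ℕ) :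
    (1 - t) * ∑ d ∈ range n, (d.choose (j + 1) : R) * t ^ (d + 1) =
      t * ∑ d ∈ range n, (d.choose j : R) * t ^ (d + 1) - (n.choose (j + 1) : R) * t ^ (n + 1) := by
  induction n with
  | zero => simp
  | succ n ih =>
    rw [sum_range_succ, sum_range_succ, mul_add, ih, Nat.choose_succ_succ' n j]
    push_cast
    ring

theorem pow_succ_dvd_pow_sub_sum_choose {t w : R} (hw : w * (1 - t) = 1) (n j : ℕ) :
    t ^ (n + 1) ∣ (t * w) ^ (j + 1) - ∑ d ∈ range n, (d.choose j : R) * t ^ (d + 1) := by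
  induction j with
  | zero =>
    have hsum : ∑ d ∈ range n, (d.choose 0 : R) * t ^ (d + 1) = t * ∑ d ∈ range n, t ^ d := by
      simp [mul_sum, pow_succ']
    rw [hsum]
    exact ⟨w, by linear_combination (t * ∑ d ∈ range n, t ^ d) * hw - t * w * mul_neg_geom_sum t n⟩
  | succ j ih =>
    obtain ⟨c, hc⟩ := ih
    exact ⟨w * t * c + w * n.choose (j + 1), by
      linear_combination (∑ d ∈ range n, (d.choose (j + 1) : R) * t ^ (d + 1)) * hw -
        w * one_sub_mul_sum_choose_mul_pow t j n + w * t * hc⟩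

/-- When `w = 1 / (1 - t)`, the argument `-(t * w)` is `t / (t - 1)`, and the hypothesis `hg` is
invariance of the power series with coefficients `g` under this involution, one coefficient at a
time. -/
theorem pow_succ_dvd_sum_reflect_sub_sum {t w : R} (hw : w * (1 - t) = 1) (n : ℕ) (g : ℕ → R)
    (hg : ∀ d < n, ∑ j ∈ range (d + 1), (-1) ^ (j + 1) * (d.choose j : R) * g j = g d) :
    t ^ (n + 1) ∣ ∑ j ∈ range n, g j * (-(t * w)) ^ (j + 1) - ∑ j ∈ range n, g j * t ^ (j + 1) := by
  have hswap : ∑ j ∈ range n, g j * t ^ (j + 1) = ∑ j ∈ range n,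
      g j * (-1) ^ (j + 1) * ∑ d ∈ range n, (d.choose j : R) * t ^ (d + 1) := by
    simp_rw [mul_sum]
    rw [sum_comm]
    refine sum_congr rfl fun d hd => ?_
    have hd : d + 1 ≤ n := mem_range.mp hd
    have htail : ∀ j ∈ range n, j ∉ range (d + 1) →
        g j * (-1) ^ (j + 1) * ((d.choose j : R) * t ^ (d + 1)) = 0 := fun j _ hj => by
      rw [Nat.choose_eq_zero_of_lt (by simpa using hj)]
      simp
    rw [← sum_subset (range_mono hd) htail, ← hg d hd, sum_mul]
    exact sum_congr rfl fun j _ => by ring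
  rw [hswap, ← sum_sub_distrib]
  refine dvd_sum fun j _ => ?_
  obtain ⟨c, hc⟩ := pow_succ_dvd_pow_sub_sum_choose hw n j
  refine ⟨g j * (-1) ^ (j + 1) * c, ?_⟩
  rw [neg_pow (t * w)]
  linear_combination g j * (-1) ^ (j + 1) * hc

theorem exists_sum_reflect_sub_sum_eq {S : Subring R} {t w : R} (htS : t ∈ S) (hwS : w ∈ S)
    (hw : w * (1 - t) = 1) (n : ℕ) {g : ℕ → R} (hgS : ∀ j < n, g j ∈ S)
    (hg : ∀ d < n, ∑ j ∈ range (d + 1), (-1) ^ (j + 1) * (d.choose j : R) * g j = g d) :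
    ∃ r ∈ S, ∑ j ∈ range n, g j * (-(t * w)) ^ (j + 1) - ∑ j ∈ range n, g j * t ^ (j + 1) =
      t ^ (n + 1) * r := by
  lift t to S using htS
  lift w to S using hwS
  choose! c hc using fun (j : ℕ) (hj : j < n) => (⟨⟨g j, hgS j hj⟩, rfl⟩ : ∃ c : S, (c : R) = g j)
  have hunit : w * (1 - t) = 1 := Subtype.ext (mod_cast hw)
  obtain ⟨r, hr⟩ := pow_succ_dvd_sum_reflect_sub_sum hunit n c fun d hd => by
    apply Subtype.ext
    push_cast
    rw [hc d hd, ← hg d hd]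
    exact sum_congr rfl fun j hj => by rw [hc j (by rw [mem_range] at hj; omega)]
  refine ⟨r, r.2, ?_⟩
  have hr := congrArg Subtype.val hr
  push_cast at hr
  rw [← hr]
  congr 1 <;> exact sum_congr rfl fun j hj => by rw [hc j (mem_range.mp hj)]

end Reflection

section Products

open Finset

variable {M : Type*} [CommMonoid M]

@[to_additive]
theorem prod_Icc_mul_reflect (f : ℕ → M) (m : ℕ) :
    ∏ k ∈ Icc 1 m, f k * f (2 * m + 1 - k) = ∏ k ∈ Icc 1 (2 * m), f k := by
  rw [prod_mul_distrib,
    ← prod_filter_mul_prod_filter_not (Icc 1 (2 * m)) (fun k => k ≤ m)]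
  congr 1
  · exact prod_congr (by ext k; simp only [mem_Icc, mem_filter]; omega) fun _ _ => rfl
  · refine prod_nbij' (fun k => 2 * m + 1 - k) (fun k => 2 * m + 1 - k) ?_ ?_ ?_ ?_ ?_ <;>
      intro k hk <;> simp only [mem_Icc, mem_filter] at hk ⊢ <;> omega

@[to_additive]
theorem prod_Icc_even_mul_odd (f : ℕ → M) (m : ℕ) :
    ∏ k ∈ Icc 1 m, f (2 * k) * f (2 * m + 1 - 2 * k) = ∏ k ∈ Icc 1 (2 * m), f k := by
  rw [prod_mul_distrib, ← prod_filter_mul_prod_filter_not (Icc 1 (2 * m)) (fun k => Even k)]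
  congr 1
  · refine prod_nbij' (fun k => 2 * k) (fun k => k / 2) ?_ ?_ ?_ ?_ ?_ <;>
      intro k hk <;> simp only [mem_Icc, mem_filter, Nat.even_iff] at hk ⊢ <;> omega
  · refine prod_nbij' (fun k => 2 * m + 1 - 2 * k) (fun k => (2 * m + 1 - k) / 2)
      ?_ ?_ ?_ ?_ ?_ <;>
      intro k hk <;> simp only [mem_Icc, mem_filter, Nat.even_iff] at hk ⊢ <;> omega

/-- Both sides are `(2m)!` divided by `∏ (-k²)`. -/
theorem four_pow_mul_prod_one_sub_div {K : Type*} [Field K] [CharZero K] (m : ℕ) :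
    4 ^ m * ∏ k ∈ Icc 1 m, (1 - (2 * m + 1) / (2 * k) : K) =
      ∏ k ∈ Icc 1 m, (1 - (2 * m + 1) / k : K) := by
  have hfour : (4 : K) ^ m = ∏ _k ∈ Icc 1 m, (4 : K) := by simp
  have hfactorial := (prod_Icc_even_mul_odd (fun k => (k : K)) m).trans
    (prod_Icc_mul_reflect (fun k => (k : K)) m).symm
  calc 4 ^ m * ∏ k ∈ Icc 1 m, (1 - (2 * m + 1) / (2 * k) : K)
      = ∏ k ∈ Icc 1 m, ((2 * k : ℕ) * (2 * m + 1 - 2 * k : ℕ) / (-k ^ 2) : K) := by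
        rw [hfour, ← prod_mul_distrib]
        refine prod_congr rfl fun k hk => ?_
        rw [mem_Icc] at hk
        have hk0 : (k : K) ≠ 0 := Nat.cast_ne_zero.mpr (by omega)
        rw [Nat.cast_sub (by omega)]
        push_cast
        field_simp
        ring
    _ = ∏ k ∈ Icc 1 m, ((k : ℕ) * (2 * m + 1 - k : ℕ) / (-k ^ 2) : K) := by
        rw [prod_div_distrib, prod_div_distrib, hfactorial]
    _ = ∏ k ∈ Icc 1 m, (1 - (2 * m + 1) / k : K) := by
        refine prod_congr rfl fun k hk => ?_
        rw [mem_Icc] at hk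
        have hk0 : (k : K) ≠ 0 := Nat.cast_ne_zero.mpr (by omega)
        rw [Nat.cast_sub (by omega)]
        push_cast
        field_simp
        ring

end Products

section CoefficientSubring

open Polynomial

variable {A : Type*} [CommRing A] {R : Subring A}

theorem mem_liftsRing_of_X_pow_mul_mem {n : ℕ} {f : A[X]}
    (hf : X ^ n * f ∈ liftsRing R.subtype) : f ∈ liftsRing R.subtype := by
  rw [← lifts_iff_liftsRing, lifts_iff_coeff_lifts] at hf ⊢
  intro d
  simpa only [coeff_X_pow_mul] using hf (d + n)

theorem eval_mem_of_mem_liftsRing {f : A[X]} (hf : f ∈ liftsRing R.subtype) {x : A} (hx : x ∈ R) :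
    f.eval x ∈ R := by
  obtain ⟨q, rfl⟩ := hf
  lift x to R using hx
  rw [coe_mapRingHom, ← Subring.coe_subtype, eval_map, eval₂_at_apply]
  exact (q.eval x).2

end CoefficientSubring

section TruncatedLogarithm

open Finset Polynomial

variable {A : Type*} [CommRing A] [Algebra ℚ A]

/-- The truncation `∑_{i=1}^{n} (-1)^(i-1) (u - 1)^i / i` of the logarithm series, as a function of
`u` rather than of `u - 1` so that it turns products into sums. -/
def truncLog (n : ℕ) (u : A) : A :=
  ∑ j ∈ range n, ((-1 : ℚ) ^ j / (j + 1)) • (u - 1) ^ (j + 1)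

theorem truncLog_one (n : ℕ) : truncLog n (1 : A) = 0 := by
  simp [truncLog]

theorem truncLog_succ (n : ℕ) (u : A) :
    truncLog (n + 1) u = truncLog n u + ((-1 : ℚ) ^ n / (n + 1)) • (u - 1) ^ (n + 1) :=
  sum_range_succ _ _

theorem map_truncLog {B : Type*} [CommRing B] [Algebra ℚ B] (φ : A →+* B) (n : ℕ) (u : A) :
    φ (truncLog n u) = truncLog n (φ u) := by
  simp [truncLog, map_rat_smul]

theorem mul_derivative_truncLog (n : ℕ) (f : A[X]) :
    f * derivative (truncLog n f) = (1 - (1 - f) ^ n) * derivative f := by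
  have hterm (j : ℕ) : derivative (((-1 : ℚ) ^ j / (j + 1)) • (f - 1) ^ (j + 1)) =
      (1 - f) ^ j * derivative f := by
    have hj : ((-1 : ℚ) ^ j / (j + 1)) * ((j + 1 : ℕ) : ℚ) = (-1) ^ j := by
      push_cast
      field_simp
    rw [derivative_smul, derivative_pow_succ, derivative_sub, derivative_one, sub_zero,
      ← neg_sub f 1, neg_pow (f - 1)]
    have hcast : C ((j : A) + 1) = ((j + 1 : ℕ) : ℚ) • (1 : A[X]) := by
      rw [Nat.cast_smul_eq_nsmul]
      simp
    rw [hcast, smul_mul_assoc, smul_mul_assoc, smul_smul, hj, one_mul, mul_assoc, Algebra.smul_def]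
    simp
  have hgeom := mul_neg_geom_sum (1 - f) n
  rw [truncLog, derivative_sum, sum_congr rfl fun j _ => hterm j, ← sum_mul]
  linear_combination derivative f * hgeom

theorem X_pow_succ_dvd_of_X_pow_dvd_derivative {R : Type*} [Semiring R] [IsAddTorsionFree R]
    {f : R[X]} {n : ℕ} (h0 : f.coeff 0 = 0) (hd : X ^ n ∣ derivative f) : X ^ (n + 1) ∣ f := by
  rw [X_pow_dvd_iff] at hd ⊢
  rintro (_ | d) hdn
  · exact h0
  · have h := hd d (by omega)
    rw [coeff_derivative, ← Nat.cast_succ, ← nsmul_eq_mul'] at h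
    exact (smul_eq_zero_iff_right d.succ_ne_zero).mp h

theorem X_pow_succ_dvd_truncLog_mul (n : ℕ) {f g : A[X]} (hf : X ∣ f - 1) (hg : X ∣ g - 1) :
    X ^ (n + 1) ∣ truncLog n (f * g) - truncLog n f - truncLog n g := by
  have : IsAddTorsionFree A := .of_module_rat A
  have hfg : X ∣ f * g - 1 := by
    convert dvd_add (hf.mul_right g) hg using 1
    ring
  have hpow {h : A[X]} (hh : X ∣ h - 1) : X ^ n ∣ (1 - h) ^ n :=
    pow_dvd_pow_of_dvd ((dvd_sub_comm).mp hh) n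
  apply X_pow_succ_dvd_of_X_pow_dvd_derivative
  · have hone {h : A[X]} (hh : X ∣ h - 1) : constantCoeff h = 1 := by
      rw [X_dvd_iff, ← constantCoeff_apply, map_sub, map_one] at hh
      exact sub_eq_zero.mp hh
    rw [← constantCoeff_apply]
    simp only [map_sub, map_truncLog, hone hf, hone hg, hone hfg, truncLog_one, sub_zero]
  · have hcop : IsCoprime (X ^ n) (f * g) := by
      obtain ⟨c, hc⟩ := hfg
      exact IsCoprime.pow_left ⟨-c, 1, by linear_combination hc⟩
    have hderiv : f * g * derivative (truncLog n (f * g) - truncLog n f - truncLog n g) =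
        (1 - f) ^ n * (g * derivative f) + (1 - g) ^ n * (f * derivative g) -
          (1 - f * g) ^ n * derivative (f * g) := by
      rw [derivative_sub, derivative_sub]
      linear_combination mul_derivative_truncLog n (f * g) - g * mul_derivative_truncLog n f -
        f * mul_derivative_truncLog n g + derivative_mul (f := f) (g := g)
    refine hcop.dvd_of_dvd_mul_left ?_
    rw [hderiv]
    exact dvd_sub (dvd_add ((hpow hf).mul_right _) ((hpow hg).mul_right _)) ((hpow hfg).mul_right _)

variable {R : Subring A} {π : A}

theorem C_mul_truncLog_mem_liftsRing {n : ℕ} (hdiv : ∀ j < n, ((j + 1 : ℚ)⁻¹) • π ∈ R) {f : A[X]}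
    (hf : f ∈ liftsRing R.subtype) : C π * truncLog n f ∈ liftsRing R.subtype := by
  rw [truncLog, mul_sum]
  refine sum_mem fun j hj => ?_
  have hC : C (((j + 1 : ℚ)⁻¹) • π) ∈ liftsRing R.subtype :=
    (lifts_iff_liftsRing _ _).mp (C_mem_lifts _ (⟨_, hdiv j (mem_range.mp hj)⟩ : R))
  have hsplit : C π * (((-1 : ℚ) ^ j / (j + 1)) • (f - 1) ^ (j + 1)) =
      (-1) ^ j * C (((j + 1 : ℚ)⁻¹) • π) * (f - 1) ^ (j + 1) := by
    rw [← smul_C, div_eq_mul_inv, mul_smul, Algebra.smul_def ((-1 : ℚ) ^ j)]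
    simp only [map_pow, map_neg, map_one, mul_smul_comm, smul_mul_assoc]
    congr 1
    ring
  rw [hsplit]
  exact mul_mem (mul_mem (pow_mem (neg_mem (one_mem _)) _) hC) (pow_mem (sub_mem hf (one_mem _)) _)

/-- The polynomial `L(fg) - L(f) - L(g)` for `f = 1 + aX`, `g = 1 + bX` is `X ^ (n + 1)` times
a polynomial whose coefficients are in `π⁻¹R`; evaluate at `X = π`. -/
theorem exists_truncLog_mul_eq {n : ℕ} (hdiv : ∀ j < n, ((j + 1 : ℚ)⁻¹) • π ∈ R) (hπ : π ∈ R)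
    {a b : A} (ha : a ∈ R) (hb : b ∈ R) :
    ∃ r ∈ R, truncLog n ((1 + π * a) * (1 + π * b)) - truncLog n (1 + π * a) -
      truncLog n (1 + π * b) = π ^ n * r := by
  have hlin {c : A} (hc : c ∈ R) : 1 + X * C c ∈ liftsRing R.subtype :=
    add_mem (one_mem _) (mul_mem ((lifts_iff_liftsRing _ _).mp (X_mem_lifts _))
      ((lifts_iff_liftsRing _ _).mp (C_mem_lifts _ (⟨c, hc⟩ : R))))
  obtain ⟨q, hq⟩ := X_pow_succ_dvd_truncLog_mul n (f := 1 + X * C a) (g := 1 + X * C b)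
    (by simp) (by simp)
  have hint : C π * q ∈ liftsRing R.subtype := by
    refine mem_liftsRing_of_X_pow_mul_mem (n := n + 1) ?_
    rw [mul_left_comm, ← hq, mul_sub, mul_sub]
    exact sub_mem (sub_mem (C_mul_truncLog_mem_liftsRing hdiv (mul_mem (hlin ha) (hlin hb)))
      (C_mul_truncLog_mem_liftsRing hdiv (hlin ha))) (C_mul_truncLog_mem_liftsRing hdiv (hlin hb))
  refine ⟨_, eval_mem_of_mem_liftsRing hint hπ, ?_⟩
  have heval := congrArg (evalRingHom π) hq
  simp only [map_sub, map_truncLog] at heval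
  simp only [coe_evalRingHom, eval_mul, eval_add, eval_one, eval_X, eval_C, eval_pow] at heval ⊢
  rw [heval]
  ring

end TruncatedLogarithm

section PIntegers

open Finset

theorem prime_dvd_add_mul_pow_sub_pow {R : Type*} [CommRing R] {p : ℕ} (hp : p.Prime)
    (a b c : R) : (p : R) ∣ (a + b + p * c) ^ p - a ^ p - b ^ p := by
  obtain ⟨r, hr⟩ := exists_add_pow_prime_eq hp (a + b) (p * c)
  obtain ⟨s, hs⟩ := exists_add_pow_prime_eq hp a b
  obtain ⟨k, hk⟩ : (p : R) ∣ (p * c) ^ p := dvd_pow (dvd_mul_right _ _) hp.ne_zero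
  exact ⟨k + (a + b) * (p * c) * r + a * b * s, by linear_combination hr + hs + hk⟩

/-- The ring `ℤ_(p)` of rational numbers whose denominator is prime to `p`. -/
abbrev pIntegers (p : ℕ) [Fact p.Prime] : Subring ℚ :=
  (Rat.padicValuation p).integer

/-- The fractional ideal `p ^ n ℤ_(p)`; congruence modulo `p ^ n` of rational numbers is
membership of their difference. -/
def primePowMultiples (p n : ℕ) [Fact p.Prime] : Submodule (pIntegers p) ℚ :=
  Submodule.span (pIntegers p) {(p : ℚ) ^ n}

variable {p : ℕ} [hp : Fact p.Prime]

theorem mem_pIntegers_iff {x : ℚ} : x ∈ pIntegers p ↔ ¬ p ∣ x.den := by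
  rw [Valuation.mem_integer_iff, Rat.padicValuation_le_one_iff]

theorem mem_primePowMultiples {n : ℕ} {x : ℚ} :
    x ∈ primePowMultiples p n ↔ ∃ r ∈ pIntegers p, (p : ℚ) ^ n * r = x := by
  rw [primePowMultiples, Submodule.mem_span_singleton]
  simp [Subring.smul_def, mul_comm]

theorem mul_mem_primePowMultiples {n : ℕ} {c x : ℚ} (hc : c ∈ pIntegers p)
    (hx : x ∈ primePowMultiples p n) : c * x ∈ primePowMultiples p n :=
  (primePowMultiples p n).smul_mem ⟨c, hc⟩ hx

theorem inv_natCast_mem_pIntegers {k : ℕ} (hk : ¬ p ∣ k) : (k : ℚ)⁻¹ ∈ pIntegers p := by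
  have hk0 : k ≠ 0 := by rintro rfl; exact hk (dvd_zero p)
  rwa [mem_pIntegers_iff, Rat.inv_natCast_den_of_pos (by omega)]

theorem div_natCast_mem_pIntegers {m : ℕ} (hm0 : m ≠ 0) (hm : m < 2 * p) {x : ℚ}
    (hx : x ∈ pIntegers p) (hxp : m = p → x ∈ primePowMultiples p 1) :
    x / m ∈ pIntegers p := by
  by_cases hdvd : p ∣ m
  · obtain rfl := Nat.eq_of_dvd_of_lt_two_mul hm0 hdvd hm
    obtain ⟨r, hr, rfl⟩ := mem_primePowMultiples.mp (hxp rfl)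
    rwa [pow_one, mul_div_cancel_left₀ _ (Nat.cast_ne_zero.mpr hm0)]
  · exact div_eq_mul_inv x _ ▸ mul_mem hx (inv_natCast_mem_pIntegers hdvd)

theorem natCast_div_mem_primePowMultiples {k : ℕ} (hk0 : 0 < k) (hk : k < p) :
    (p / k : ℚ) ∈ primePowMultiples p 1 :=
  mem_primePowMultiples.mpr ⟨(k : ℚ)⁻¹,
    inv_natCast_mem_pIntegers (Nat.not_dvd_of_pos_of_lt hk0 hk), by rw [pow_one, div_eq_mul_inv]⟩

theorem ratModEqPrimePow_zero_of_mul_mem {n : ℕ} {x : ℚ}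
    (hx : p * x ∈ primePowMultiples p (n + 1)) : RatModEqPrimePow p n x 0 := by
  obtain ⟨r, hr, hrx⟩ := mem_primePowMultiples.mp hx
  refine ⟨r.num, r.den, mod_cast mem_pIntegers_iff.mp hr, ?_⟩
  rw [sub_zero, Int.cast_natCast, Rat.num_div_den]
  exact mul_left_cancel₀ (Nat.cast_ne_zero.mpr hp.out.ne_zero) (by rw [← hrx]; ring)

variable (p) in
/-- The group `1 + p ℤ_(p)` on which the `p`-adic logarithm converges, as a multiplicative
submonoid of `ℚ`. -/
def principalUnits : Submonoid ℚ where
  carrier := {u | u - 1 ∈ primePowMultiples p 1}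
  one_mem' := by simp
  mul_mem' := by
    rintro u v hu hv
    obtain ⟨a, ha, hau⟩ := mem_primePowMultiples.mp hu
    have hu' : u ∈ pIntegers p := by
      rw [← sub_add_cancel u 1, ← hau]
      exact add_mem (mul_mem (pow_mem (natCast_mem _ p) 1) ha) (one_mem _)
    change u * v - 1 ∈ primePowMultiples p 1
    convert add_mem (mul_mem_primePowMultiples hu' hv) hu using 1
    ring

theorem mem_principalUnits {u : ℚ} :
    u ∈ principalUnits p ↔ u - 1 ∈ primePowMultiples p 1 :=
  Iff.rfl

theorem one_sub_natCast_div_mem_principalUnits {k : ℕ} (hk0 : 0 < k) (hk : k < p) :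
    (1 - p / k : ℚ) ∈ principalUnits p := by
  rw [mem_principalUnits, sub_sub_cancel_left]
  exact neg_mem (natCast_div_mem_primePowMultiples hk0 hk)

theorem two_pow_sub_one_mem_principalUnits (hodd : Odd p) :
    (2 : ℚ) ^ (p - 1) ∈ principalUnits p := by
  have hcop : IsCoprime (2 : ℤ) p := by
    rw [← Nat.cast_ofNat, Nat.isCoprime_iff_coprime]
    exact hodd.coprime_two_left
  obtain ⟨c, hc⟩ := (Int.ModEq.pow_card_sub_one_eq_one hp.out hcop).symm.dvd
  refine mem_primePowMultiples.mpr ⟨c, intCast_mem _ _, ?_⟩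
  rw [pow_one]
  exact_mod_cast hc.symm

theorem add_pow_succ_sub_div_mem_pIntegers {n : ℕ} (hn : n + 1 < 2 * p) {a b c : ℚ}
    (ha : a ∈ pIntegers p) (hb : b ∈ pIntegers p) (hc : c ∈ pIntegers p) :
    ((a + b + p * c) ^ (n + 1) - a ^ (n + 1) - b ^ (n + 1)) / (n + 1) ∈ pIntegers p := by
  lift a to pIntegers p using ha
  lift b to pIntegers p using hb
  lift c to pIntegers p using hc
  rw [← Nat.cast_add_one]
  refine div_natCast_mem_pIntegers n.add_one_ne_zero hn
    ((a + b + p * c) ^ (n + 1) - a ^ (n + 1) - b ^ (n + 1)).2 fun hnp => ?_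
  obtain ⟨r, hr⟩ := prime_dvd_add_mul_pow_sub_pow hp.out a b c
  rw [hnp, mem_primePowMultiples]
  exact ⟨r, r.2, by rw [pow_one]; exact_mod_cast (congrArg Subtype.val hr).symm⟩

/-- Because of its denominators, `exists_truncLog_mul_eq` is accurate only to order `p ^ n` on `n`
terms, so it is applied to `n + 1` terms; the extra ones are additive modulo `p ^ (n + 1)`, by
Frobenius if `n + 1 = p`. -/
theorem truncLog_mul_sub_mem {n : ℕ} (hn : n + 1 < 2 * p) {u v : ℚ} (hu : u ∈ principalUnits p)
    (hv : v ∈ principalUnits p) :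
    truncLog n (u * v) - truncLog n u - truncLog n v ∈ primePowMultiples p (n + 1) := by
  obtain ⟨a, ha, hau⟩ := mem_primePowMultiples.mp hu
  obtain ⟨b, hb, hbv⟩ := mem_primePowMultiples.mp hv
  obtain rfl : 1 + p * a = u := by linear_combination hau
  obtain rfl : 1 + p * b = v := by linear_combination hbv
  have hdiv : ∀ j < n + 1, ((j + 1 : ℚ)⁻¹) • (p : ℚ) ∈ pIntegers p := fun j hj => by
    rw [smul_eq_mul, inv_mul_eq_div, ← Nat.cast_add_one]
    exact div_natCast_mem_pIntegers j.add_one_ne_zero (by omega) (natCast_mem _ p) fun _ =>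
      mem_primePowMultiples.mpr ⟨1, one_mem _, by ring⟩
  obtain ⟨r, hr, hlog⟩ := exists_truncLog_mul_eq hdiv (natCast_mem _ p) ha hb
  have hlast := add_pow_succ_sub_div_mem_pIntegers hn ha hb (mul_mem ha hb)
  refine mem_primePowMultiples.mpr
    ⟨_, sub_mem hr (mul_mem (pow_mem (neg_mem (one_mem _)) n) hlast), ?_⟩
  simp only [truncLog_succ, smul_eq_mul] at hlog
  have hfactor : (1 + p * a) * (1 + p * b) - 1 = p * (a + b + p * (a * b)) := by ring
  rw [hfactor, add_sub_cancel_left, add_sub_cancel_left, mul_pow, mul_pow, mul_pow] at hlog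
  linear_combination -hlog

theorem truncLog_prod_sub_sum_mem {n : ℕ} (hn : n + 1 < 2 * p) {ι : Type*} (s : Finset ι)
    (f : ι → ℚ) (hf : ∀ i ∈ s, f i ∈ principalUnits p) :
    truncLog n (∏ i ∈ s, f i) - ∑ i ∈ s, truncLog n (f i) ∈ primePowMultiples p (n + 1) := by
  induction s using Finset.cons_induction with
  | empty => simp [truncLog_one]
  | cons i s hi ih =>
    rw [forall_mem_cons] at hf
    rw [prod_cons, sum_cons]
    convert add_mem (truncLog_mul_sub_mem hn hf.1 (prod_mem hf.2)) (ih hf.2) using 1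
    ring

end PIntegers

section EulerNumbers

open Finset PowerSeries

theorem factorial_mul_coeff_mk_mul_exp {K : Type*} [Field K] [Algebra ℚ K] (a : ℕ → K) (d : ℕ) :
    d.factorial * coeff d (mk (fun k => a k / k.factorial) * exp K) =
      ∑ k ∈ range (d + 1), d.choose k * a k := by
  have : CharZero K := algebraRat.charZero K
  rw [coeff_mul, Nat.sum_antidiagonal_eq_sum_range_succ_mk, mul_sum]
  refine sum_congr rfl fun k hk => ?_
  have hfact (i : ℕ) : (i.factorial : K) ≠ 0 := Nat.cast_ne_zero.mpr i.factorial_ne_zero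
  have := hfact k
  have := hfact (d - k)
  rw [Nat.cast_choose K (Nat.lt_succ_iff.mp (mem_range.mp hk)), coeff_mk, coeff_exp, one_div,
    map_inv₀, map_natCast]
  field_simp

/-- The value at `0` of the `m`-th Euler polynomial, defined by its expression through Bernoulli
numbers. -/
def eulerPolyZero (m : ℕ) : ℚ :=
  -2 * (2 ^ (m + 1) - 1) * bernoulli (m + 1) / (m + 1)

theorem eulerPolyZero_zero : eulerPolyZero 0 = 1 := by
  norm_num [eulerPolyZero, bernoulli_one]

theorem eulerPolyZero_eq_zero_of_even {m : ℕ} (hm : Even m) (h0 : m ≠ 0) :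
    eulerPolyZero m = 0 := by
  rw [eulerPolyZero, bernoulli_eq_zero_of_odd hm.add_one (by omega), mul_zero, zero_div]

/-- The exponential generating function of `eulerPolyZero`. -/
def eulerPolyZeroPowerSeries : PowerSeries ℚ :=
  mk fun m => eulerPolyZero m / m.factorial

theorem X_mul_eulerPolyZeroPowerSeries :
    X * eulerPolyZeroPowerSeries =
      2 * (bernoulliPowerSeries ℚ - rescale 2 (bernoulliPowerSeries ℚ)) := by
  rw [← map_ofNat (C (R := ℚ)) 2]
  ext (_ | m)
  · rw [coeff_C_mul, map_sub, coeff_rescale, pow_zero, one_mul, sub_self, mul_zero,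
      coeff_zero_X_mul]
  · have : (m.factorial : ℚ) ≠ 0 := Nat.cast_ne_zero.mpr m.factorial_ne_zero
    have : (m : ℚ) + 1 ≠ 0 := m.cast_add_one_ne_zero
    rw [coeff_C_mul, coeff_succ_X_mul]
    simp only [eulerPolyZeroPowerSeries, bernoulliPowerSeries, coeff_mk, map_sub, coeff_rescale,
      eulerPolyZero, Nat.factorial_succ, Algebra.algebraMap_self, RingHom.id_apply]
    push_cast
    field_simp
    ring

theorem eulerPolyZeroPowerSeries_mul_exp_add_one :
    eulerPolyZeroPowerSeries * (exp ℚ + 1) = 2 := by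
  have hb := bernoulliPowerSeries_mul_exp_sub_one ℚ
  have hb2 : rescale 2 (bernoulliPowerSeries ℚ) * (exp ℚ ^ 2 - 1) = 2 * X := by
    have h := congrArg (rescale (2 : ℚ)) hb
    rw [map_mul, map_sub, map_one, rescale_X, map_ofNat] at h
    rw [exp_pow_eq_rescale_exp]
    simpa using h
  have hne : X * (exp ℚ - 1) ≠ 0 := by
    refine mul_ne_zero X_ne_zero fun h => ?_
    rw [h, mul_zero] at hb
    exact X_ne_zero hb.symm
  apply mul_left_cancel₀ hne
  linear_combination (exp ℚ ^ 2 - 1) * X_mul_eulerPolyZeroPowerSeries + 2 * (exp ℚ + 1) * hb -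
    2 * hb2

theorem sum_choose_mul_eulerPolyZero {d : ℕ} (hd : d ≠ 0) :
    ∑ k ∈ range (d + 1), (d.choose k : ℚ) * eulerPolyZero k = -eulerPolyZero d := by
  have hcoeff := congrArg (coeff d) eulerPolyZeroPowerSeries_mul_exp_add_one
  rw [← map_ofNat (C (R := ℚ)) 2, coeff_C, if_neg hd, mul_add, mul_one, map_add] at hcoeff
  have : (d.factorial : ℚ) ≠ 0 := Nat.cast_ne_zero.mpr d.factorial_ne_zero
  rw [← factorial_mul_coeff_mk_mul_exp, ← eulerPolyZeroPowerSeries,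
    eq_neg_of_add_eq_zero_left hcoeff, eulerPolyZeroPowerSeries, coeff_mk]
  field_simp

theorem two_mul_eulerPolyZero {d : ℕ} (hd : d ≠ 0) :
    2 * eulerPolyZero d = -∑ k ∈ range d, (d.choose k : ℚ) * eulerPolyZero k := by
  have h := sum_choose_mul_eulerPolyZero hd
  rw [sum_range_succ, Nat.choose_self, Nat.cast_one] at h
  linarith

/-- The coefficient of `t ^ (j + 1)` in the series `∑ 2 E_{j+1}(0) / (j+1) t ^ (j+1) - log (1 - t)`,
which is invariant under `t ↦ t / (t - 1)`. -/
def reflectionCoeff (j : ℕ) : ℚ :=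
  (1 + 2 * eulerPolyZero (j + 1)) / (j + 1)

theorem sum_neg_one_pow_mul_choose_mul_reflectionCoeff (d : ℕ) :
    ∑ j ∈ range (d + 1), (-1) ^ (j + 1) * (d.choose j : ℚ) * reflectionCoeff j =
      reflectionCoeff d := by
  have hterm : ∀ j ∈ range (d + 1), (-1) ^ (j + 1) * (d.choose j : ℚ) * reflectionCoeff j =
      ((-1) ^ (j + 1) * ((d + 1).choose (j + 1) : ℚ)
        - 2 * (((d + 1).choose (j + 1) : ℚ) * eulerPolyZero (j + 1))) / (d + 1) := by
    intro j _
    have hchoose : ((d : ℚ) + 1) * d.choose j = (d + 1).choose (j + 1) * (j + 1) := by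
      exact_mod_cast Nat.add_one_mul_choose_eq d j
    have hsign : (-1) ^ (j + 1) * eulerPolyZero (j + 1) = -eulerPolyZero (j + 1) := by
      rcases Nat.even_or_odd (j + 1) with h | h
      · rw [eulerPolyZero_eq_zero_of_even h (by omega), mul_zero, neg_zero]
      · rw [h.neg_one_pow, neg_one_mul]
    rw [reflectionCoeff]
    field_simp
    linear_combination (-1) ^ (j + 1) * (1 + 2 * eulerPolyZero (j + 1)) * hchoose +
      2 * ((d + 1).choose (j + 1) : ℚ) * (j + 1) * hsign
  have heuler := sum_choose_mul_eulerPolyZero d.add_one_ne_zero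
  have halternating : ∑ j ∈ range (d + 1 + 1), (-1 : ℚ) ^ j * ((d + 1).choose j : ℚ) = 0 := by
    exact_mod_cast Int.alternating_sum_range_choose_of_ne d.add_one_ne_zero
  rw [sum_range_succ'] at heuler halternating
  simp only [Nat.choose_zero_right, pow_zero, Nat.cast_one, eulerPolyZero_zero]
    at heuler halternating
  rw [sum_congr rfl hterm, ← sum_div, sum_sub_distrib, ← mul_sum, reflectionCoeff]
  congr 1
  linarith

variable {p : ℕ} [hp : Fact p.Prime]

theorem inv_two_mem_pIntegers (hodd : Odd p) : (2 : ℚ)⁻¹ ∈ pIntegers p := by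
  have h : ¬ p ∣ 2 := fun h => hp.out.one_lt.ne'
    (Nat.dvd_one.mp (hodd.coprime_two_right ▸ Nat.dvd_gcd dvd_rfl h))
  exact_mod_cast inv_natCast_mem_pIntegers h

theorem eulerPolyZero_mem_pIntegers (hodd : Odd p) (m : ℕ) : eulerPolyZero m ∈ pIntegers p := by
  induction m using Nat.strong_induction_on with
  | _ m ih =>
    rcases eq_or_ne m 0 with rfl | hm
    · exact eulerPolyZero_zero ▸ one_mem _
    · rw [← inv_mul_cancel_left₀ two_ne_zero (eulerPolyZero m), two_mul_eulerPolyZero hm]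
      exact mul_mem (inv_two_mem_pIntegers hodd) (neg_mem (sum_mem fun k hk =>
        mul_mem (natCast_mem _ _) (ih k (mem_range.mp hk))))

theorem one_add_two_mul_eulerPolyZero_prime_mem (hodd : Odd p) :
    1 + 2 * eulerPolyZero p ∈ primePowMultiples p 1 := by
  obtain ⟨q, hq⟩ := Nat.exists_eq_succ_of_ne_zero hp.out.ne_zero
  have hsum : 1 + 2 * eulerPolyZero p =
      -∑ k ∈ range q, eulerPolyZero (k + 1) * (p.choose (k + 1) : ℚ) := by
    rw [two_mul_eulerPolyZero hp.out.ne_zero]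
    conv_lhs => rw [show range p = range (q + 1) by rw [hq]]
    rw [sum_range_succ', eulerPolyZero_zero, Nat.choose_zero_right]
    simp only [mul_comm (eulerPolyZero _)]
    push_cast
    ring
  rw [hsum]
  refine neg_mem (sum_mem fun k hk => mul_mem_primePowMultiples
    (eulerPolyZero_mem_pIntegers hodd _) ?_)
  rw [mem_range] at hk
  obtain ⟨c, hc⟩ := hp.out.dvd_choose_self k.add_one_ne_zero (by omega)
  exact mem_primePowMultiples.mpr ⟨c, natCast_mem _ c, by rw [hc, pow_one, Nat.cast_mul]⟩

theorem reflectionCoeff_mem_pIntegers (hodd : Odd p) {j : ℕ} (hj : j + 1 < 2 * p) :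
    reflectionCoeff j ∈ pIntegers p := by
  rw [reflectionCoeff, ← Nat.cast_add_one]
  refine div_natCast_mem_pIntegers j.add_one_ne_zero hj
    (add_mem (one_mem _) (mul_mem (ofNat_mem _ 2) (eulerPolyZero_mem_pIntegers hodd _))) ?_
  intro hjp
  rw [hjp]
  exact one_add_two_mul_eulerPolyZero_prime_mem hodd

end EulerNumbers

section Sums

open Finset

/-- The truncation at degree `n` of the series `∑ 2 E_{j+1}(0) / (j+1) t ^ (j+1)`. -/
def eulerSum (n : ℕ) (t : ℚ) : ℚ :=
  ∑ j ∈ range n, 2 * eulerPolyZero (j + 1) / (j + 1) * t ^ (j + 1)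

/-- The truncation at degree `n` of the power series with coefficients `reflectionCoeff`. -/
def reflectionSum (n : ℕ) (t : ℚ) : ℚ :=
  ∑ j ∈ range n, reflectionCoeff j * t ^ (j + 1)

theorem eulerSum_eq (n : ℕ) (t : ℚ) :
    eulerSum n t = truncLog n (1 - t) + reflectionSum n t := by
  rw [eulerSum, truncLog, reflectionSum, ← sum_add_distrib]
  refine sum_congr rfl fun j _ => ?_
  have hsign : (-1 : ℚ) ^ j * (-1) ^ j = 1 := by rw [← mul_pow, neg_one_mul, neg_neg, one_pow]
  rw [smul_eq_mul, sub_sub_cancel_left, neg_pow t, pow_succ (-1 : ℚ), reflectionCoeff]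
  linear_combination t ^ (j + 1) / (j + 1) * hsign

theorem mul_sum_bernoulli_genHarmonic_eq (x : ℚ) (n m : ℕ) :
    x * ∑ j ∈ range n,
        ((2 : ℚ) ^ (j + 1) - 1) / ((j : ℚ) + 1) * (((2 : ℚ) ^ (j + 2) - 1) / ((j : ℚ) + 2)) *
          (bernoulli (j + 2) / (2 : ℚ) ^ ((j : ℤ) - 1)) * genHarmonic (j + 1) m * x ^ j =
      ∑ k ∈ Icc 1 m, (eulerSum n (x / (2 * k : ℕ)) - eulerSum n (x / k)) := by
  simp_rw [eulerSum, ← sum_sub_distrib]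
  rw [sum_comm, mul_sum]
  refine sum_congr rfl fun j _ => ?_
  rw [genHarmonic, mul_sum, sum_mul, mul_sum]
  refine sum_congr rfl fun k hk => ?_
  have hk0 : (k : ℚ) ≠ 0 := Nat.cast_ne_zero.mpr (by rw [mem_Icc] at hk; omega)
  have hj : (j : ℚ) + 1 + 1 = j + 2 := by ring
  rw [eulerPolyZero, zpow_sub₀ two_ne_zero, zpow_natCast, zpow_one]
  push_cast
  rw [div_pow, div_pow, mul_pow, hj]
  field_simp
  ring

theorem mul_sum_fermatQuotientTwo_eq {p : ℕ} (hp : p ≠ 0) (n : ℕ) :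
    (p : ℚ) * ∑ j ∈ range n,
        (-1 : ℚ) ^ j * (fermatQuotientTwo p ^ (j + 1) / ((j : ℚ) + 1)) * (p : ℚ) ^ j =
      truncLog n ((2 : ℚ) ^ (p - 1)) := by
  have hquot : (2 : ℚ) ^ (p - 1) - 1 = p * fermatQuotientTwo p :=
    (mul_div_cancel₀ _ (Nat.cast_ne_zero.mpr hp)).symm
  rw [truncLog, mul_sum, hquot]
  refine sum_congr rfl fun j _ => ?_
  rw [smul_eq_mul, mul_pow]
  ring

variable {p : ℕ} [hp : Fact p.Prime]

theorem reflectionSum_reflect_sub_mem (hodd : Odd p) {n k : ℕ} (hn : n + 1 < 2 * p) (hk0 : 0 < k)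
    (hk : k < p) :
    reflectionSum n (p / (p - k : ℕ)) - reflectionSum n (p / k) ∈
      primePowMultiples p (n + 1) := by
  have hkq : (k : ℚ) ≠ 0 := Nat.cast_ne_zero.mpr hk0.ne'
  have hpkq : ((p - k : ℕ) : ℚ) ≠ 0 := Nat.cast_ne_zero.mpr (by omega)
  have hpk : (p : ℚ) - k = (p - k : ℕ) := (Nat.cast_sub hk.le).symm
  have hkinv : (k : ℚ)⁻¹ ∈ pIntegers p :=
    inv_natCast_mem_pIntegers (Nat.not_dvd_of_pos_of_lt hk0 hk)
  have hpkinv : ((p - k : ℕ) : ℚ)⁻¹ ∈ pIntegers p :=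
    inv_natCast_mem_pIntegers (Nat.not_dvd_of_pos_of_lt (by omega) (by omega))
  have hunit : -(k * ((p - k : ℕ) : ℚ)⁻¹) * (1 - p * (k : ℚ)⁻¹) = 1 := by
    rw [← hpk] at hpkq ⊢
    field_simp
    ring
  have hreflect : -(p * (k : ℚ)⁻¹ * -(k * ((p - k : ℕ) : ℚ)⁻¹)) = p / (p - k : ℕ) := by
    field_simp
  obtain ⟨r, hr, hsum⟩ := exists_sum_reflect_sub_sum_eq (mul_mem (natCast_mem _ p) hkinv)
    (neg_mem (mul_mem (natCast_mem _ k) hpkinv)) hunit n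
    (fun j hj => reflectionCoeff_mem_pIntegers hodd (by omega))
    (fun d _ => sum_neg_one_pow_mul_choose_mul_reflectionCoeff d)
  rw [hreflect, mul_pow, mul_assoc, ← div_eq_mul_inv] at hsum
  exact mem_primePowMultiples.mpr ⟨_, mul_mem (pow_mem hkinv (n + 1)) hr, hsum.symm⟩

theorem sum_reflectionSum_sub_mem {n m : ℕ} (hn : n + 1 < 2 * p) (hm : p = 2 * m + 1) :
    ∑ k ∈ Icc 1 m, reflectionSum n (p / (2 * k : ℕ)) - ∑ k ∈ Icc 1 m, reflectionSum n (p / k) ∈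
      primePowMultiples p (n + 1) := by
  have hodd : Odd p := ⟨m, hm⟩
  set f : ℕ → ℚ := fun k => reflectionSum n (p / k)
  have hreflect {r : ℕ} (hr0 : 0 < r) (hr : r < p) :
      f (p - r) - f r ∈ primePowMultiples p (n + 1) :=
    reflectionSum_reflect_sub_mem hodd hn hr0 hr
  have hall := sum_mem fun k (hk : k ∈ Icc 1 m) => hreflect (r := k)
    (by rw [mem_Icc] at hk; omega) (by rw [mem_Icc] at hk; omega)
  have heven := sum_mem fun k (hk : k ∈ Icc 1 m) => hreflect (r := 2 * k)
    (by rw [mem_Icc] at hk; omega) (by rw [mem_Icc] at hk; omega)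
  have hpairs := (sum_Icc_add_reflect f m).trans (sum_Icc_even_add_odd f m).symm
  rw [← hm] at hpairs
  convert mul_mem_primePowMultiples (inv_two_mem_pIntegers hodd) (sub_mem hall heven) using 1
  simp only [sum_add_distrib, sum_sub_distrib] at hpairs ⊢
  linarith

theorem truncLog_two_pow_add_sum_sub_sum_mem {n m : ℕ} (hn : n + 1 < 2 * p) (hm : p = 2 * m + 1) :
    truncLog n ((2 : ℚ) ^ (p - 1)) + ∑ k ∈ Icc 1 m, truncLog n (1 - p / (2 * k : ℕ) : ℚ) -
      ∑ k ∈ Icc 1 m, truncLog n (1 - p / k : ℚ) ∈ primePowMultiples p (n + 1) := by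
  have hunit : ∀ k ∈ Icc 1 m, (1 - p / k : ℚ) ∈ principalUnits p := fun k hk => by
    rw [mem_Icc] at hk
    exact one_sub_natCast_div_mem_principalUnits (by omega) (by omega)
  have hunit_even : ∀ k ∈ Icc 1 m, (1 - p / (2 * k : ℕ) : ℚ) ∈ principalUnits p := fun k hk => by
    rw [mem_Icc] at hk
    exact one_sub_natCast_div_mem_principalUnits (by omega) (by omega)
  have hprod : (2 : ℚ) ^ (p - 1) * ∏ k ∈ Icc 1 m, (1 - p / (2 * k : ℕ) : ℚ) =
      ∏ k ∈ Icc 1 m, (1 - p / k : ℚ) := by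
    rw [show p - 1 = 2 * m by omega, pow_mul, hm]
    convert four_pow_mul_prod_one_sub_div (K := ℚ) m using 2 <;> norm_num
  have hmul := truncLog_mul_sub_mem hn (two_pow_sub_one_mem_principalUnits ⟨m, hm⟩)
    (prod_mem hunit_even)
  rw [hprod] at hmul
  convert sub_mem (sub_mem (truncLog_prod_sub_sum_mem hn _ _ hunit)
    (truncLog_prod_sub_sum_mem hn _ _ hunit_even)) hmul using 1
  ring

end Sums

theorem mainTheorem1 (p n : ℕ) (hp : p.Prime) (hodd : Odd p) (hn : 1 ≤ n)
    (hpn : ((n : ℚ) + 1) / 2 < (p : ℚ)) :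
    RatModEqPrimePow p n
      ((∑ j ∈ Finset.range n,
          ((2 : ℚ) ^ (j + 1) - 1) / ((j : ℚ) + 1) * (((2 : ℚ) ^ (j + 2) - 1) / ((j : ℚ) + 2)) *
            (bernoulli (j + 2) / (2 : ℚ) ^ ((j : ℤ) - 1)) *
            genHarmonic (j + 1) ((p - 1) / 2) * (p : ℚ) ^ j) +
        ∑ j ∈ Finset.range n,
          (-1 : ℚ) ^ j * (fermatQuotientTwo p ^ (j + 1) / ((j : ℚ) + 1)) * (p : ℚ) ^ j)
      0 := by
  have : Fact p.Prime := ⟨hp⟩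
  obtain ⟨m, hm⟩ := hodd
  have hlt : n + 1 < 2 * p := by
    rw [div_lt_iff₀' two_pos] at hpn
    exact_mod_cast hpn
  have hhalf : (p - 1) / 2 = m := by omega
  have hlog := truncLog_two_pow_add_sum_sub_sum_mem hlt hm
  have hreflection := sum_reflectionSum_sub_mem hlt hm
  apply ratModEqPrimePow_zero_of_mul_mem
  rw [hhalf, mul_add, mul_sum_bernoulli_genHarmonic_eq, mul_sum_fermatQuotientTwo_eq hp.ne_zero]
  convert add_mem hlog hreflection using 1
  simp only [eulerSum_eq, Finset.sum_sub_distrib, Finset.sum_add_distrib]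
  ring
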